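/- Let $1\le k\le n$ be integers and let $A\in M_n(\mathbb{C})$. For $1\le m\le n$ let $\mathcal{X}_m=\{X\in M_{n,m}(\mathbb{C}): X^*X=I_m\}$ be the set of $n\times m$ isometries and $\mathcal{Y}_m=\{XX^*: X\in\mathcal{X}_m\}$ the set of orthogonal projections of rank $m$ on $\mathbb{C}^n$. The $k$-rank numerical range of $A$ is $$\Lambda_k(A)=\{\lambda\in\mathbb{C}: X^*AX=\lambda I_k\text{ for some }X\in\mathcal{X}_k\},$$ and the numerical range of $B\in M_m(\mathbb{C})$ is $F(B)=\{x^*Bx: x\in\mathbb{C}^m,\ x^*x=1\}$. For an orthogonal projection $P$ let $F(PAP)$ denote the numerical range of the compression $PAP$ regarded as an operator on the subspace $P\mathbb{C}^n$, that is, $F(PAP)=\{x^*PAPx: x\in P\mathbb{C}^n,\ x^*x=1\}$. Then $$\Lambda_k(A)=\bigcap_{M\in\mathcal{X}_{n-k+1}}F(M^*AM)=\bigcap_{P\in\mathcal{Y}_{n-k+1}}F(PAP).$$ -/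

import Mathlib

open Matrix

namespace HigherRank

/-- The set `𝒳_m` of `n × m` isometries: complex `n × m` matrices `X` with `X* X = I_m`. -/
def isometries (n m : ℕ) : Set (Matrix (Fin n) (Fin m) ℂ) :=
  {X | Xᴴ * X = 1}

/-- The set `𝒴_m` of orthogonal projections of rank `m` in `M_n(ℂ)`: the matrices `X X*` with
`X` an `n × m` isometry. -/
def projections (n m : ℕ) : Set (Matrix (Fin n) (Fin n) ℂ) :=
  {P | ∃ X ∈ isometries n m, P = X * Xᴴ}

/-- The `k`-rank numerical range
`Λ_k(A) = {λ : X* A X = λ I_k for some n × k isometry X}`. -/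
def rankNumericalRange {n : ℕ} (k : ℕ) (A : Matrix (Fin n) (Fin n) ℂ) : Set ℂ :=
  {z | ∃ X ∈ isometries n k, Xᴴ * A * X = z • (1 : Matrix (Fin k) (Fin k) ℂ)}

/-- The (classical) numerical range `F(B) = {x* B x : x ∈ ℂ^m, x* x = 1}`. -/
def numericalRange {m : ℕ} (B : Matrix (Fin m) (Fin m) ℂ) : Set ℂ :=
  {z | ∃ x : Fin m → ℂ, star x ⬝ᵥ x = 1 ∧ star x ⬝ᵥ (B *ᵥ x) = z}

/-- The numerical range of the compression `PAP` of `A` to the range of `P`, that is, of `PAP`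
regarded as an operator on the subspace `P(ℂ^n)`:
`{x* (P A P) x : x ∈ P(ℂ^n), x* x = 1}`. -/
def compressionNumericalRange {n : ℕ} (P A : Matrix (Fin n) (Fin n) ℂ) : Set ℂ :=
  {z | ∃ x ∈ LinearMap.range P.mulVecLin,
    star x ⬝ᵥ x = 1 ∧ star x ⬝ᵥ ((P * A * P) *ᵥ x) = z}

/-- The equivalent form of the definition:
`Λ_k(A) = {λ : P A P = λ P for some orthogonal projection P of rank k}`. -/
theorem mem_rankNumericalRange_iff_projection {n k : ℕ} (A : Matrix (Fin n) (Fin n) ℂ) (z : ℂ) :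
    z ∈ rankNumericalRange k A ↔ ∃ P ∈ projections n k, P * A * P = z • P := by
  constructor
  · rintro ⟨X, hX, h⟩
    refine ⟨X * Xᴴ, ⟨X, hX, rfl⟩, ?_⟩
    calc X * Xᴴ * A * (X * Xᴴ) = X * (Xᴴ * A * X) * Xᴴ := by simp only [Matrix.mul_assoc]
      _ = z • (X * Xᴴ) := by rw [h]; simp
  · rintro ⟨P, ⟨X, hX, rfl⟩, h⟩
    have hX' : Xᴴ * X = 1 := hX
    refine ⟨X, hX, ?_⟩
    calc Xᴴ * A * X = (Xᴴ * X) * Xᴴ * A * X * (Xᴴ * X) := by rw [hX']; simp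
      _ = Xᴴ * (X * Xᴴ * A * (X * Xᴴ)) * X := by simp only [Matrix.mul_assoc]
      _ = z • ((Xᴴ * X) * (Xᴴ * X)) := by rw [h]; simp [Matrix.mul_assoc]
      _ = z • 1 := by rw [hX']; simp

end HigherRank

/-! ### Converse interlacing for real diagonal matrices. -/

namespace HigherRank

/-! One inclusion is a dimension count: a `k`-dimensional and an `(n-k+1)`-dimensional subspace of
`ℂ^n` share a nonzero vector. For the other, put `B(x, y) = x* (A - z) y`. If `z` lies in every
`F(M* A M)`, then for no `c` is the Hermitian form `Re (c B)` negative definite on a subspace of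
dimension `n-k+1`. It remains to find a totally isotropic subspace of `B` of dimension `k`
(`exists_isotropic_submodule`), by induction on the dimension.

Take an eigenvector `u` of the pencil spanned by `B` and its adjoint; its two-sided orthogonal
complement has codimension at most one. If `u` is isotropic, pass to a complement of `u` inside that
space: the index bound survives with `k-1` in place of `k` (`exists_reduction`), and `u` is adjoined
to the subspace found there. If no eigenvector is isotropic, splitting them off one at a time gives
a `B`-orthogonal basis, and no two diagonal values lie on opposite rays.

In the diagonal case, discard basis vectors while the index bound persists. At a minimal set some
`c` makes exactly `k` values positive and the other `m` negative. Rescaled, they become `1 + i a_j`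
and `-(1 + i b_j)`, and the bound for the other `c` forces `b_j < a_j < b_{j+m-k}`. Hence there is a
real isometry `Y` with `Yᵀ diag(b) Y = diag(a)`, and the graph of `Y` is isotropic. Such a `Y` comes
from a Gauss quadrature with nodes `a` for a measure on the points `b`. -/

theorem sum_range_two_mul_add_one {M : Type*} [AddCommMonoid M] (F : ℕ → M) (l : ℕ) :
    ∑ i ∈ Finset.range (2 * l + 1), F i =
      ∑ q ∈ Finset.range (l + 1), F (2 * q) + ∑ q ∈ Finset.range l, F (2 * q + 1) := by
  induction l with
  | zero => simp
  | succ l ih =>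
    rw [show 2 * (l + 1) + 1 = 2 * l + 1 + 1 + 1 by ring, Finset.sum_range_succ,
      Finset.sum_range_succ, ih, Finset.sum_range_succ (fun q => F (2 * q)) (l + 1),
      Finset.sum_range_succ (fun q => F (2 * q + 1)), show 2 * l + 1 + 1 = 2 * (l + 1) by ring]
    abel

/-- The sum is a divided difference, i.e. the top coefficient of the interpolation polynomial, which
is `f` itself and has lower degree. -/
theorem sum_nodalWeight_mul_eval_eq_zero {F ι : Type*} [Field F] [DecidableEq ι] {s : Finset ι}
    {v : ι → F} (hv : Set.InjOn v s) {f : Polynomial F} (hf : f.natDegree + 1 < s.card) :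
    ∑ i ∈ s, Lagrange.nodalWeight s v i * f.eval (v i) = 0 := by
  have h := Lagrange.coeff_eq_sum (P := f) hv (by
    exact lt_of_le_of_lt Polynomial.degree_le_natDegree (by exact_mod_cast (by omega)))
  rw [Polynomial.coeff_eq_zero_of_natDegree_lt (by omega)] at h
  rw [h]
  refine Finset.sum_congr rfl fun i hi => ?_
  rw [Lagrange.nodalWeight, Finset.prod_inv_distrib, div_eq_mul_inv, mul_comm]

/-- The nodal weights of an increasing sequence of nodes alternate in sign. -/
theorem nodalWeight_sign {N : ℕ} {v : ℕ → ℝ} (hv : StrictMonoOn v (Set.Iio N)) {i : ℕ}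
    (hi : i < N) :
    0 < (-1 : ℝ) ^ (N - 1 - i) * Lagrange.nodalWeight (Finset.range N) v i := by
  have hsplit : (Finset.range N).erase i = Finset.range i ∪ Finset.Ioo i N := by
    ext j; simp; omega
  have hdisj : Disjoint (Finset.range i) (Finset.Ioo i N) := by
    rw [Finset.disjoint_left]; intro j; simp; omega
  rw [Lagrange.nodalWeight, hsplit, Finset.prod_union hdisj, mul_left_comm]
  have hcard : N - 1 - i = (Finset.Ioo i N).card := by simp; omega
  rw [hcard, ← Finset.prod_const, ← Finset.prod_mul_distrib]
  refine mul_pos (Finset.prod_pos fun j hj => ?_) (Finset.prod_pos fun j hj => ?_)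
  · have hj' := Finset.mem_range.1 hj
    have := hv (show j ∈ Set.Iio N from hj'.trans hi) (show i ∈ Set.Iio N from hi) hj'
    exact inv_pos.2 (by linarith)
  · have hj' := Finset.mem_Ioo.1 hj
    have := hv (show i ∈ Set.Iio N from hi) (show j ∈ Set.Iio N from hj'.2) hj'.1
    have : (v i - v j)⁻¹ < 0 := inv_lt_zero.2 (by linarith)
    linarith

/-- A converse of Cauchy interlacing, in the strict case and in codimension one. -/
theorem exists_isometry_of_strict_interlacing (a b : ℕ → ℝ) (l : ℕ) (h₁ : ∀ j < l, b j < a j)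
    (h₂ : ∀ j < l, a j < b (j + 1)) :
    ∃ Y : ℕ → ℕ → ℝ, ∀ j < l, ∀ j' < l,
      (∑ i ∈ Finset.range (l + 1), Y i j * Y i j' = if j = j' then 1 else 0) ∧
      (∑ i ∈ Finset.range (l + 1), b i * (Y i j * Y i j') = if j = j' then a j else 0) := by
  -- The interleaved nodes `b 0 < a 0 < b 1 < ⋯ < a (l-1) < b l`.
  set v : ℕ → ℝ := fun i => if i % 2 = 0 then b (i / 2) else a (i / 2) with hvdef
  have hve : ∀ q, v (2 * q) = b q := fun q => by simp [hvdef]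
  have hvo : ∀ q, v (2 * q + 1) = a q := fun q => by
    simp only [hvdef]
    rw [if_neg (by omega), show (2 * q + 1) / 2 = q by omega]
  have hmono : StrictMonoOn v (Set.Iio (2 * l + 1)) := by
    refine strictMonoOn_of_lt_add_one Set.ordConnected_Iio fun i _ _ hi => ?_
    simp only [Set.mem_Iio] at hi
    rcases Nat.even_or_odd' i with ⟨q, rfl | rfl⟩
    · rw [hve, hvo]; exact h₁ q (by omega)
    · rw [hvo, show 2 * q + 1 + 1 = 2 * (q + 1) by ring, hve]; exact h₂ q (by omega)
  set w := Lagrange.nodalWeight (Finset.range (2 * l + 1)) v with hw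
  have hwe : ∀ q < l + 1, 0 < w (2 * q) := fun q hq => by
    have := nodalWeight_sign hmono (i := 2 * q) (by omega)
    rwa [show 2 * l + 1 - 1 - 2 * q = 2 * (l - q) by omega, pow_mul, neg_one_sq, one_pow,
      one_mul] at this
  have hwo : ∀ q < l, 0 < - w (2 * q + 1) := fun q hq => by
    have := nodalWeight_sign hmono (i := 2 * q + 1) (by omega)
    rwa [show 2 * l + 1 - 1 - (2 * q + 1) = 2 * (l - q - 1) + 1 by omega, pow_succ, pow_mul,
      neg_one_sq, one_pow, one_mul, neg_one_mul] at this
  have hinj : Set.InjOn v (Finset.range (2 * l + 1)) := by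
    have := hmono.injOn
    convert this using 1
    ext; simp
  -- Weights are positive at the `b`'s and negative at the `a`'s, so the vanishing divided
  -- difference is a quadrature rule with positive weights, exact up to degree `2 * l - 1`.
  have key : ∀ f : Polynomial ℝ, f.natDegree + 1 < 2 * l + 1 →
      ∑ q ∈ Finset.range (l + 1), w (2 * q) * f.eval (b q) =
        ∑ q ∈ Finset.range l, (- w (2 * q + 1)) * f.eval (a q) := fun f hf => by
    have h := sum_nodalWeight_mul_eval_eq_zero hinj (f := f) (by simpa using hf)
    rw [sum_range_two_mul_add_one] at h
    simp only [hve, hvo] at h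
    simp only [neg_mul, Finset.sum_neg_distrib]
    linarith
  have ainj : ∀ i < l, ∀ j < l, a i = a j → i = j := fun i hi j hj h => by
    have := hinj (x₁ := 2 * i + 1) (x₂ := 2 * j + 1) (by simp; omega) (by simp; omega)
      (by rw [hvo, hvo, h])
    omega
  set p : ℕ → Polynomial ℝ := fun j => Lagrange.nodal ((Finset.range l).erase j) a with hp
  have hpdeg : ∀ j < l, (p j).natDegree = l - 1 := fun j hj => by
    rw [hp]; simp only [Lagrange.natDegree_nodal]
    rw [Finset.card_erase_of_mem (by simpa using hj), Finset.card_range]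
  have hp0 : ∀ j < l, ∀ q < l, q ≠ j → (p j).eval (a q) = 0 := fun j _ q hq hqj =>
    Lagrange.eval_nodal_at_node (by simp [hqj, hq])
  have hpne : ∀ j < l, (p j).eval (a j) ≠ 0 := fun j hj => by
    rw [hp]; simp only [Lagrange.eval_nodal]
    refine Finset.prod_ne_zero_iff.2 fun q hq h => ?_
    simp only [Finset.mem_erase, Finset.mem_range] at hq
    exact hq.1 (ainj q hq.2 j hj (by linarith))
  -- The degree is at most `1 + 2 * (l - 1)`, just within the exactness range: `g = 1` gives
  -- orthogonality and `g = X` the compression of multiplication by the variable.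
  have key' : ∀ g : Polynomial ℝ, g.natDegree ≤ 1 → ∀ j < l, ∀ j' < l,
      ∑ q ∈ Finset.range (l + 1), w (2 * q) * (g.eval (b q) * ((p j).eval (b q) * (p j').eval (b q)))
      = if j = j' then (- w (2 * j + 1)) * (g.eval (a j) * (p j).eval (a j) ^ 2) else 0 := by
    intro g hg j hj j' hj'
    have hdeg : (g * (p j * p j')).natDegree ≤ 1 + ((l - 1) + (l - 1)) :=
      Polynomial.natDegree_mul_le.trans (add_le_add hg
        (Polynomial.natDegree_mul_le.trans (by rw [hpdeg j hj, hpdeg j' hj'])))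
    have h := key (g * (p j * p j')) (by omega)
    simp only [Polynomial.eval_mul] at h
    rw [h]
    rw [Finset.sum_eq_single j]
    · split_ifs with hjj
      · subst hjj; ring
      · rw [hp0 j' hj' j hj hjj]; ring
    · intro q hq hqj
      rw [hp0 j hj q (by simpa using hq) hqj]; ring
    · intro h; simp [hj] at h
  refine ⟨fun i j => √(w (2 * i)) * (p j).eval (b i) / (√(- w (2 * j + 1)) * (p j).eval (a j)), ?_⟩
  intro j hj j' hj'
  have fin : ∀ g : Polynomial ℝ, g.natDegree ≤ 1 →
      ∑ i ∈ Finset.range (l + 1), g.eval (b i) *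
        ((√(w (2 * i)) * (p j).eval (b i) / (√(- w (2 * j + 1)) * (p j).eval (a j))) *
        (√(w (2 * i)) * (p j').eval (b i) / (√(- w (2 * j' + 1)) * (p j').eval (a j'))))
      = if j = j' then g.eval (a j) else 0 := by
    intro g hg
    have : ∀ i ∈ Finset.range (l + 1), g.eval (b i) *
        ((√(w (2 * i)) * (p j).eval (b i) / (√(- w (2 * j + 1)) * (p j).eval (a j))) *
        (√(w (2 * i)) * (p j').eval (b i) / (√(- w (2 * j' + 1)) * (p j').eval (a j'))))
        = w (2 * i) * (g.eval (b i) * ((p j).eval (b i) * (p j').eval (b i))) *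
          ((√(- w (2 * j + 1)) * (p j).eval (a j)) * (√(- w (2 * j' + 1)) * (p j').eval (a j')))⁻¹ := by
      intro i hi
      have hs := Real.mul_self_sqrt (hwe i (by simpa using hi)).le
      rw [div_mul_div_comm, div_eq_mul_inv]
      linear_combination (g.eval (b i) * (p j).eval (b i) * (p j').eval (b i) *
          ((√(- w (2 * j + 1)) * (p j).eval (a j)) * (√(- w (2 * j' + 1)) * (p j').eval (a j')))⁻¹) * hs
    rw [Finset.sum_congr rfl this, ← Finset.sum_mul, key' g hg j hj j' hj']
    split_ifs with hjj
    · subst hjj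
      have hs := Real.mul_self_sqrt (hwo j hj).le
      have h2 := hpne j hj
      have h1 : w (2 * j + 1) ≠ 0 := neg_ne_zero.1 (hwo j hj).ne'
      rw [mul_mul_mul_comm, hs]
      field_simp
    · simp
  exact ⟨by simpa using fin 1 (by simp), by simpa using fin Polynomial.X (by simp)⟩

/-- A converse of Cauchy interlacing, in the strict case: if `b j < a j < b (j + d)` for `j < k`,
then `diag(b₀, …, b_{k+d-1})` compresses to `diag(a₀, …, a_{k-1})`. -/
theorem exists_isometry_of_interlacing (a b : ℕ → ℝ) (k d : ℕ) (hd : 0 < d)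
    (h₁ : ∀ j < k, b j < a j) (h₂ : ∀ j < k, a j < b (j + d)) :
    ∃ Y : ℕ → ℕ → ℝ, ∀ j < k, ∀ j' < k,
      (∑ i ∈ Finset.range (k + d), Y i j * Y i j' = if j = j' then 1 else 0) ∧
      (∑ i ∈ Finset.range (k + d), b i * (Y i j * Y i j') = if j = j' then a j else 0) := by
  -- The indices split into residue classes modulo `d`, where the strict case applies. The class of
  -- `r` contains `(k + d - 1 - r) / d` of the `a`'s and one more of the `b`'s.
  have hlt : ∀ r < d, ∀ q, q < (k + d - 1 - r) / d ↔ r + q * d < k := fun r hr q => by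
    rw [Nat.lt_iff_add_one_le, Nat.le_div_iff_mul_le hd, add_mul]; omega
  have hlt' : ∀ r < d, ∀ q, q < (k + d - 1 - r) / d + 1 ↔ r + q * d < k + d := fun r hr q => by
    rcases q with _ | q
    · simp; omega
    · rw [Nat.add_lt_add_iff_right, hlt r hr, add_mul]; omega
  have ex : ∀ r, ∃ Y : ℕ → ℕ → ℝ, r < d → ∀ j < (k + d - 1 - r) / d, ∀ j' < (k + d - 1 - r) / d,
      (∑ i ∈ Finset.range ((k + d - 1 - r) / d + 1), Y i j * Y i j' = if j = j' then 1 else 0) ∧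
      (∑ i ∈ Finset.range ((k + d - 1 - r) / d + 1), b (r + i * d) * (Y i j * Y i j') =
        if j = j' then a (r + j * d) else 0) := by
    intro r
    by_cases hr : r < d
    · obtain ⟨Y, hY⟩ := exists_isometry_of_strict_interlacing (fun q => a (r + q * d))
        (fun q => b (r + q * d)) ((k + d - 1 - r) / d)
        (fun j hj => h₁ _ ((hlt r hr j).1 hj))
        (fun j hj => by
          have := h₂ _ ((hlt r hr j).1 hj)
          rwa [add_assoc, ← Nat.succ_mul] at this)
      exact ⟨Y, fun _ => hY⟩
    · exact ⟨0, fun h => absurd h hr⟩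
  choose Y hY using ex
  refine ⟨fun i j => if i % d = j % d then Y (j % d) (i / d) (j / d) else 0, ?_⟩
  intro j hj j' hj'
  by_cases hjj : j % d = j' % d
  · have hr := Nat.mod_lt j hd
    have dm := fun x => (Nat.mod_add_div' x d)
    have hq : j / d < (k + d - 1 - j % d) / d := (hlt _ hr _).2 (by rwa [dm])
    have hq' : j' / d < (k + d - 1 - j % d) / d := (hlt _ hr _).2 (by rwa [hjj, dm])
    have heq : j / d = j' / d ↔ j = j' := ⟨fun h => by rw [← dm j, ← dm j', hjj, h], fun h => by rw [h]⟩
    have hsum : ∀ F : ℕ → ℝ, ∑ i ∈ Finset.range (k + d), (if i % d = j % d then F i else 0) =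
        ∑ q ∈ Finset.range ((k + d - 1 - j % d) / d + 1), F (j % d + q * d) := by
      intro F
      rw [← Finset.sum_filter]
      refine Finset.sum_nbij' (fun i => i / d) (fun q => j % d + q * d) ?_ ?_ ?_ ?_ ?_
      · intro i hi
        simp only [Finset.mem_filter, Finset.mem_range] at hi ⊢
        rw [hlt' _ hr, ← hi.2, dm]; exact hi.1
      · intro q hq
        simp only [Finset.mem_filter, Finset.mem_range] at hq ⊢
        exact ⟨(hlt' _ hr q).1 hq, by simp⟩
      · intro i hi
        simp only [Finset.mem_filter, Finset.mem_range] at hi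
        rw [← hi.2, dm]
      · intro q hq
        rw [Nat.add_mul_div_right _ _ hd, Nat.div_eq_of_lt hr, zero_add]
      · intro i hi
        simp only [Finset.mem_filter, Finset.mem_range] at hi
        rw [← hi.2, dm]
    obtain ⟨e1, e2⟩ := hY (j % d) hr _ hq _ hq'
    simp only [heq] at e1 e2
    rw [dm] at e2
    have hdiv : ∀ q, (j % d + q * d) / d = q := fun q => by
      rw [Nat.add_mul_div_right _ _ hd, Nat.div_eq_of_lt hr, zero_add]
    constructor
    · rw [← e1, Finset.sum_congr rfl (g := fun i => if i % d = j % d then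
        Y (j % d) (i / d) (j / d) * Y (j % d) (i / d) (j' / d) else 0), hsum]
      · simp only [hdiv]
      · intro i _; simp only [← hjj]; split_ifs <;> simp
    · rw [← e2, Finset.sum_congr rfl (g := fun i => if i % d = j % d then
        b i * (Y (j % d) (i / d) (j / d) * Y (j % d) (i / d) (j' / d)) else 0), hsum]
      · simp only [hdiv]
      · intro i _; simp only [← hjj]; split_ifs <;> simp
  · have hne : j ≠ j' := fun h => hjj (by rw [h])
    have hz : ∀ i, (if i % d = j % d then Y (j % d) (i / d) (j / d) else 0) *
        (if i % d = j' % d then Y (j' % d) (i / d) (j' / d) else 0) = 0 := by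
      intro i
      split_ifs with h1 h2
      · exact absurd (h1.symm.trans h2) hjj
      all_goals simp
    simp [hz, hne]

end HigherRank
-- Negative definite subspaces and isotropic reduction.
namespace HigherRank
section
open Filter Topology Module
variable {V : Type*} [AddCommGroup V] [Module ℂ V]

/-- The real part of `c • B x x` is negative on the nonzero vectors of `N`. -/
def NegOn (B : V →ₗ⋆[ℂ] V →ₗ[ℂ] ℂ) (c : ℂ) (N : Submodule ℂ V) : Prop :=
  ∀ x ∈ N, x ≠ 0 → (c * B x x).re < 0

/-- The two-sided orthogonal complement of `u`. -/
def orth (B : V →ₗ⋆[ℂ] V →ₗ[ℂ] ℂ) (u : V) : Submodule ℂ V :=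
  LinearMap.ker (B u) ⊓ LinearMap.ker (B.flip u)

theorem mem_orth {B : V →ₗ⋆[ℂ] V →ₗ[ℂ] ℂ} {u y : V} :
    y ∈ orth B u ↔ B u y = 0 ∧ B y u = 0 := by
  simp [orth]

theorem re_conj_mul_mul (c s t : ℂ) : (c * (starRingEnd ℂ s * (s * t))).re = ‖s‖ ^ 2 * (c * t).re := by
  rw [show c * (starRingEnd ℂ s * (s * t)) = (s * starRingEnd ℂ s) * (c * t) by ring,
    Complex.mul_conj, Complex.normSq_eq_norm_sq, Complex.re_ofReal_mul]

theorem map_smul_smul_self (B : V →ₗ⋆[ℂ] V →ₗ[ℂ] ℂ) (s : ℂ) (x : V) :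
    B (s • x) (s • x) = starRingEnd ℂ s * (s * B x x) := by
  simp only [LinearMap.map_smulₛₗ, LinearMap.smul_apply, map_smul, smul_eq_mul]
  ring

/-- The strict inequality on the compact unit sphere of `N` persists for nearby `c`, and homogeneity
extends it to all nonzero vectors. -/
theorem NegOn.eventually [FiniteDimensional ℂ V] {B : V →ₗ⋆[ℂ] V →ₗ[ℂ] ℂ} {c : ℂ}
    {N : Submodule ℂ V} (h : NegOn B c N) : ∀ᶠ c' in 𝓝 c, NegOn B c' N := by
  set b := finBasis ℂ N
  set f : (Fin (finrank ℂ N) → ℂ) → V := fun x => ((b.equivFun.symm x : N) : V) with hf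
  have hB : ∀ x, B (f x) (f x) =
      ∑ i, ∑ j, starRingEnd ℂ (x i) * (x j * B (b i) (b j)) := fun x => by
    simp only [hf, Basis.equivFun_symm_apply, Submodule.coe_sum, Submodule.coe_smul, map_sum,
      LinearMap.sum_apply, LinearMap.map_smulₛₗ, LinearMap.smul_apply, smul_eq_mul, map_smul,
      Finset.mul_sum]
    rw [Finset.sum_comm]
    exact Finset.sum_congr rfl fun _ _ => Finset.sum_congr rfl fun _ _ => by ring
  have hcont : Continuous fun z : ℂ × (Fin (finrank ℂ N) → ℂ) =>
      (z.1 * B (f z.2) (f z.2)).re := by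
    simp only [hB]
    fun_prop
  have hev := (isCompact_sphere (0 : Fin (finrank ℂ N) → ℂ) 1).eventually_forall_of_forall_eventually
    (x₀ := c) (P := fun c' x => (c' * B (f x) (f x)).re < 0) (fun y hy => by
      refine hcont.continuousAt.eventually_lt continuousAt_const (h _ (Subtype.mem _) ?_)
      intro h0
      have : y = 0 := by
        have h1 : b.equivFun.symm y = 0 := Subtype.ext h0
        exact (LinearEquiv.map_eq_zero_iff _).1 h1
      rw [this] at hy; simp at hy)
  filter_upwards [hev] with c' hc' x hx hx0
  obtain ⟨y, hy⟩ : ∃ y, f y = x := ⟨b.equivFun ⟨x, hx⟩, by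
    simp only [hf, LinearEquiv.symm_apply_apply]⟩
  have hy0 : y ≠ 0 := by rintro rfl; apply hx0; rw [← hy]; simp [hf]
  have hn : 0 < ‖y‖ := norm_pos_iff.2 hy0
  have hz := hc' (((‖y‖⁻¹ : ℝ) : ℂ) • y) (by
    rw [mem_sphere_zero_iff_norm, norm_smul, Complex.norm_real, norm_inv, norm_norm,
      inv_mul_cancel₀ hn.ne'])
  have hfs : f (((‖y‖⁻¹ : ℝ) : ℂ) • y) = ((‖y‖⁻¹ : ℝ) : ℂ) • x := by
    rw [← hy]; simp only [hf, map_smul, Submodule.coe_smul]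
  rw [hfs, map_smul_smul_self, re_conj_mul_mul] at hz
  by_contra hcon
  have := mul_nonneg (sq_nonneg ‖((‖y‖⁻¹ : ℝ) : ℂ)‖) (not_lt.1 hcon)
  linarith

theorem finrank_sup_span_singleton [FiniteDimensional ℂ V] {N : Submodule ℂ V} {v : V} (hv : v ∉ N) :
    finrank ℂ (N ⊔ Submodule.span ℂ {v} : Submodule ℂ V) = finrank ℂ N + 1 := by
  have h0 : v ≠ 0 := fun h => hv (h ▸ N.zero_mem)
  have h := Submodule.finrank_sup_add_finrank_inf_eq N (Submodule.span ℂ {v})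
  rw [finrank_span_singleton h0] at h
  have : N ⊓ Submodule.span ℂ {v} = ⊥ := by
    rw [← disjoint_iff]
    exact (Submodule.disjoint_span_singleton' h0).2 hv
  rw [this, finrank_bot] at h
  omega

/-- A negative definite subspace orthogonal to an isotropic vector `u` that is not in the radical
of the Hermitian form `Re (c • B)` can be enlarged. -/
theorem NegOn.exists_finrank_succ [FiniteDimensional ℂ V] {B : V →ₗ⋆[ℂ] V →ₗ[ℂ] ℂ} {c : ℂ}
    {N : Submodule ℂ V} (h : NegOn B c N) {u z : V} (hu : B u u = 0) (hN : N ≤ orth B u)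
    (hz : c * B u z + starRingEnd ℂ (c * B z u) ≠ 0) :
    ∃ N' : Submodule ℂ V, NegOn B c N' ∧ finrank ℂ N' = finrank ℂ N + 1 := by
  set H : V → V → ℂ := fun x y => c * B x y + starRingEnd ℂ (c * B y x) with hH
  have Hself : ∀ x, (H x x).re = 2 * (c * B x x).re := fun x => by
    simp only [hH, Complex.add_re, Complex.conj_re]; ring
  have Hadd : ∀ x y y', H x (y + y') = H x y + H x y' := fun x y y' => by
    simp only [hH, map_add, LinearMap.add_apply, mul_add]; ring
  have Hsmul : ∀ (s : ℂ) x y, H x (s • y) = s * H x y := fun s x y => by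
    simp only [hH, map_smul, LinearMap.map_smulₛₗ, LinearMap.smul_apply, smul_eq_mul, map_mul,
      Complex.conj_conj]; ring
  have Hconj : ∀ x y, starRingEnd ℂ (H x y) = H y x := fun x y => by
    simp only [hH, map_add, Complex.conj_conj]; ring
  set b := finBasis ℂ N
  let φ : N →ₗ[ℂ] (Fin (finrank ℂ N) → ℂ) :=
    { toFun := fun n i => H (b i) n
      map_add' := fun x y => by ext i; simp [Hadd]
      map_smul' := fun s x => by ext i; simp [Hsmul] }
  have Hspan : ∀ y, (∀ i, H (b i) y = 0) → ∀ n ∈ N, H n y = 0 := fun y hy n hn => by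
    have hyn : ∀ m : N, H y m = 0 := fun m => by
      rw [← b.sum_repr m]
      let ψ : N →ₗ[ℂ] ℂ :=
        { toFun := fun n => H y n
          map_add' := fun x y => by simp [Hadd]
          map_smul' := fun s x => by simp [Hsmul] }
      change ψ _ = 0
      rw [map_sum]
      refine Finset.sum_eq_zero fun i _ => ?_
      rw [map_smul]
      change _ • H y (b i) = 0
      rw [← Hconj, hy i]; simp
    rw [← Hconj, hyn ⟨n, hn⟩, map_zero]
  -- The Hermitian form `H` is definite on `N`, so `z` can be corrected by an element of `N` to
  -- become `H`-orthogonal to `N`.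
  have hφ : Function.Injective φ := by
    rw [← LinearMap.ker_eq_bot, LinearMap.ker_eq_bot']
    intro n hn
    by_contra hne
    have h1 := h n n.2 (by simpa using hne)
    have h2 := Hspan n (fun i => congrFun hn i) n n.2
    have h3 := Hself n
    rw [h2] at h3
    simp only [Complex.zero_re] at h3
    linarith
  have hφs : Function.Surjective φ :=
    (LinearMap.injective_iff_surjective_of_finrank_eq_finrank (by simp)).1 hφ
  obtain ⟨n, hn⟩ := hφs fun i => H (b i) z
  set z' : V := z + (-1 : ℂ) • (n : V) with hz'
  have hNz' : ∀ m ∈ N, H m z' = 0 := Hspan z' fun i => by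
    have : H (b i) n = H (b i) z := congrFun hn i
    rw [hz', Hadd, Hsmul, this]; ring
  have hNu : ∀ m ∈ N, H m u = 0 := fun m hm => by
    have := mem_orth.1 (hN hm)
    simp [hH, this]
  have huz' : H u z' ≠ 0 := by
    rw [hz', Hadd, Hsmul, ← Hconj (n : V) u, hNu n n.2]
    simpa [hH] using hz
  set p := H z' u with hp
  have hp0 : p ≠ 0 := by rw [hp, ← Hconj]; simpa using huz'
  have hpn : 0 < ‖p‖ ^ 2 := by positivity
  -- Since `u` is isotropic, adding `s • u` changes `H z' z'` by `2 Re (s p) = -2 t ‖p‖²`; this `t`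
  -- makes the result `-1`.
  set t : ℝ := ((H z' z').re + 1) / (2 * ‖p‖ ^ 2) with ht
  set s : ℂ := -(t : ℂ) * starRingEnd ℂ p with hs
  set v : V := z' + s • u with hv
  have hNv : ∀ m ∈ N, H m v = 0 := fun m hm => by
    rw [hv, Hadd, Hsmul, hNz' m hm, hNu m hm]; ring
  have hvv : (H v v).re = -1 := by
    have e : H v v = H z' z' + (s * p + starRingEnd ℂ (s * p)) := by
      have h1 : H z' v = H z' z' + s * p := by rw [hv, Hadd, Hsmul]
      have h2 : H u v = starRingEnd ℂ p := by
        rw [hv, Hadd, Hsmul, hp, Hconj]; simp [hH, hu]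
      rw [← Hconj v v]
      conv_lhs => rw [show H v v = H v z' + s * H v u by conv_lhs => rw [hv]
                                                         rw [← hv]
                                                         rw [Hadd, Hsmul]]
      rw [map_add, map_mul, Hconj, Hconj, h1, h2, map_mul (starRingEnd ℂ) s p]; ring
    have e2 : (s * p).re = - t * ‖p‖ ^ 2 := by
      have : s * p = ((-t * ‖p‖ ^ 2 : ℝ) : ℂ) := by
        rw [hs, mul_assoc, mul_comm (starRingEnd ℂ p) p, Complex.mul_conj,
          Complex.normSq_eq_norm_sq]
        push_cast; ring
      rw [this, Complex.ofReal_re]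
    rw [e, Complex.add_re (H z' z'), Complex.add_re (s * p), Complex.conj_re, e2, ht]
    field_simp
    ring
  have hvN : v ∉ N := fun hvN => by
    have := hNv v hvN
    rw [this] at hvv; norm_num at hvv
  refine ⟨N ⊔ Submodule.span ℂ {v}, ?_, finrank_sup_span_singleton hvN⟩
  intro x hx hx0
  obtain ⟨m, hm, w, hw, rfl⟩ := Submodule.mem_sup.1 hx
  obtain ⟨a, rfl⟩ := Submodule.mem_span_singleton.1 hw
  have e : H (m + a • v) (m + a • v) = H m m + (starRingEnd ℂ a * (a * H v v)) := by
    have h1 : H m (m + a • v) = H m m := by rw [Hadd, Hsmul, hNv m hm]; ring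
    have h2 : H v (m + a • v) = a * H v v := by
      rw [Hadd, Hsmul, ← Hconj m v, hNv m hm]; simp
    rw [← Hconj (m + a • v) (m + a • v), Hadd (m + a • v), Hsmul, map_add, map_mul, Hconj, Hconj,
      h1, h2]
  have e2 : 2 * (c * B (m + a • v) (m + a • v)).re = 2 * (c * B m m).re - ‖a‖ ^ 2 := by
    rw [← Hself, e, Complex.add_re, Hself]
    have := re_conj_mul_mul 1 a (H v v)
    rw [one_mul, one_mul, hvv] at this
    rw [this]; ring
  by_cases hm0 : m = 0
  · subst hm0
    have ha : a ≠ 0 := by rintro rfl; simp at hx0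
    have : 0 < ‖a‖ ^ 2 := by positivity
    simp only [map_zero, mul_zero, Complex.zero_re] at e2
    linarith
  · have h1 := h m hm hm0
    have : 0 ≤ ‖a‖ ^ 2 := by positivity
    linarith

/-- Splitting off an isotropic vector whose orthogonal complement has codimension at most one. -/
theorem exists_reduction [FiniteDimensional ℂ V] {B : V →ₗ⋆[ℂ] V →ₗ[ℂ] ℂ} {u : V} (hu : u ≠ 0)
    (huu : B u u = 0) (hW : finrank ℂ V ≤ finrank ℂ (orth B u) + 1) {k : ℕ}
    (h : ∀ c N, NegOn B c N → finrank ℂ N + k ≤ finrank ℂ V) :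
    ∃ V' : Submodule ℂ V, V' ≤ orth B u ∧ u ∉ V' ∧ finrank ℂ V' < finrank ℂ V ∧
      ∀ c N, N ≤ V' → NegOn B c N → finrank ℂ N + k ≤ finrank ℂ V' + 1 := by
  obtain ⟨Q, hQ⟩ := (Submodule.span ℂ {u}).exists_isCompl
  have huW : u ∈ orth B u := mem_orth.2 ⟨huu, huu⟩
  have hQ1 := Submodule.finrank_add_eq_of_isCompl hQ
  rw [finrank_span_singleton hu] at hQ1
  have hsup : Q ⊔ orth B u = ⊤ := by
    rw [eq_top_iff, ← hQ.sup_eq_top, sup_comm]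
    exact sup_le_sup_left ((Submodule.span_singleton_le_iff_mem _ _).2 huW) _
  have hdim := Submodule.finrank_sup_add_finrank_inf_eq Q (orth B u)
  rw [hsup, finrank_top] at hdim
  refine ⟨Q ⊓ orth B u, inf_le_right, fun hmem => ?_, by
    have := Submodule.finrank_le (orth B u); omega, ?_⟩
  · exact hu ((Submodule.disjoint_def.1 hQ.disjoint) u (Submodule.mem_span_singleton_self u) hmem.1)
  intro c N hN hneg
  -- If `u` is in the two-sided radical, `V'` has codimension one and the old bound suffices.
  -- Otherwise the codimension is two, and `N` must first be enlarged by one dimension.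
  by_cases hWV : finrank ℂ (orth B u) = finrank ℂ V
  · have := h c N hneg
    omega
  have hne : ∃ z, B u z ≠ 0 ∨ B z u ≠ 0 := by
    by_contra hcon
    push Not at hcon
    apply hWV
    rw [show orth B u = ⊤ from eq_top_iff.2 fun z _ => mem_orth.2 (hcon z), finrank_top]
  obtain ⟨z, hz⟩ := hne
  have hW' := Submodule.finrank_le (orth B u)
  suffices ∃ c', NegOn B c' N ∧ c' * B u z + starRingEnd ℂ (c' * B z u) ≠ 0 by
    obtain ⟨c', hc', hcz⟩ := this
    obtain ⟨N', hN', hfin⟩ := hc'.exists_finrank_succ huu (hN.trans inf_le_right) hcz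
    have := h c' N' hN'
    omega
  -- A bad `c` can be moved slightly: if the pairing of `u` and `z` vanished at `c`, `c + ε/2` and
  -- `c + iε/2`, then both `B u z` and `B z u` would be zero.
  obtain ⟨ε, hε, hball⟩ := Metric.eventually_nhds_iff.1 hneg.eventually
  by_contra hcon
  push Not at hcon
  have h0 := hcon c hneg
  have h1 := hcon (c + (ε / 2 : ℝ)) (hball (by
    rw [dist_eq_norm, add_sub_cancel_left, Complex.norm_real, Real.norm_of_nonneg (by positivity)]
    linarith))
  have h2 := hcon (c + (ε / 2 : ℝ) * Complex.I) (hball (by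
    rw [dist_eq_norm, add_sub_cancel_left, norm_mul, Complex.norm_I, mul_one, Complex.norm_real,
      Real.norm_of_nonneg (by positivity)]
    linarith))
  have he : ((ε / 2 : ℝ) : ℂ) ≠ 0 := by exact_mod_cast (by positivity : ε / 2 ≠ 0)
  simp only [map_mul, map_add, Complex.conj_ofReal, Complex.conj_I] at h0 h1 h2
  have k1 : B u z + starRingEnd ℂ (B z u) = 0 := by
    apply mul_left_cancel₀ he
    linear_combination h1 - h0
  have k2 : B u z - starRingEnd ℂ (B z u) = 0 := by
    apply mul_left_cancel₀ (mul_ne_zero he Complex.I_ne_zero)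
    linear_combination h2 - h0
  have k3 : B u z = 0 := by linear_combination (k1 + k2) / 2
  have k4 : starRingEnd ℂ (B z u) = 0 := by linear_combination (k1 - k2) / 2
  rcases hz with hz | hz
  · exact hz k3
  · exact hz (by simpa using k4)

end
end HigherRank
-- Eigenvectors of the pencil and orthogonal bases.
namespace HigherRank
section
open Filter Topology Module
universe u
variable {V : Type u} [AddCommGroup V] [Module ℂ V]

/-- `u` is an eigenvector of the pencil spanned by `B` and its adjoint form. -/
def IsPencilEigenvector (B : V →ₗ⋆[ℂ] V →ₗ[ℂ] ℂ) (u : V) : Prop :=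
  ∃ α β : ℂ, (α ≠ 0 ∨ β ≠ 0) ∧ ∀ y, α * B y u + β * starRingEnd ℂ (B u y) = 0

theorem isPencilEigenvector_of_basis {ι : Type*} [Fintype ι] {B : V →ₗ⋆[ℂ] V →ₗ[ℂ] ℂ}
    (e : Basis ι ℂ V) {u : V} {α β : ℂ} (hαβ : α ≠ 0 ∨ β ≠ 0)
    (h : ∀ i, α * B (e i) u + β * starRingEnd ℂ (B u (e i)) = 0) : IsPencilEigenvector B u := by
  refine ⟨α, β, hαβ, fun y => ?_⟩
  rw [← e.sum_repr y]
  simp only [map_sum, LinearMap.sum_apply, LinearMap.map_smulₛₗ, LinearMap.smul_apply, map_smul,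
    smul_eq_mul, map_mul, Finset.mul_sum]
  rw [← Finset.sum_add_distrib]
  refine Finset.sum_eq_zero fun i _ => ?_
  linear_combination (starRingEnd ℂ (e.repr y i)) * h i

/-- Conjugating `B u ·` makes both sides of the pencil linear in `u`. If `L` is invertible, an
eigenvector of `L⁻¹ R` works; otherwise a kernel vector of `L` does. -/
theorem exists_isPencilEigenvector [FiniteDimensional ℂ V] [Nontrivial V]
    (B : V →ₗ⋆[ℂ] V →ₗ[ℂ] ℂ) : ∃ u, u ≠ 0 ∧ IsPencilEigenvector B u := by
  set e := finBasis ℂ V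
  let L : V →ₗ[ℂ] (Fin (finrank ℂ V) → ℂ) :=
    { toFun := fun u i => B (e i) u
      map_add' := fun x y => by ext i; simp
      map_smul' := fun s x => by ext i; simp }
  let R : V →ₗ[ℂ] (Fin (finrank ℂ V) → ℂ) :=
    { toFun := fun u i => starRingEnd ℂ (B u (e i))
      map_add' := fun x y => by ext i; simp
      map_smul' := fun s x => by ext i; simp }
  by_cases hL : Function.Injective L
  · let Le := LinearMap.linearEquivOfInjective L hL (by simp)
    obtain ⟨μ, hμ⟩ := Module.End.exists_eigenvalue (Le.symm.toLinearMap ∘ₗ R)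
    obtain ⟨u, hu⟩ := hμ.exists_hasEigenvector
    refine ⟨u, hu.2, isPencilEigenvector_of_basis e (α := μ) (β := -1) (by simp) fun i => ?_⟩
    have h1 : Le.symm (R u) = μ • u := hu.apply_eq_smul
    have h2 : R u = L (μ • u) := by
      rw [← h1]; exact (Le.apply_symm_apply (R u)).symm
    have h3 : starRingEnd ℂ (B u (e i)) = B (e i) (μ • u) := congrFun h2 i
    rw [h3, map_smul, smul_eq_mul]; ring
  · rw [← LinearMap.ker_eq_bot, ← ne_eq, Submodule.ne_bot_iff] at hL
    obtain ⟨u, hu, hu0⟩ := hL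
    refine ⟨u, hu0, isPencilEigenvector_of_basis e (α := 1) (β := 0) (by simp) fun i => ?_⟩
    have : B (e i) u = 0 := congrFun (LinearMap.mem_ker.1 hu) i
    simp [this]

theorem finrank_le_finrank_ker_add_one [FiniteDimensional ℂ V] (f : V →ₗ[ℂ] ℂ) :
    finrank ℂ V ≤ finrank ℂ (LinearMap.ker f) + 1 := by
  have h := f.finrank_range_add_finrank_ker
  have := (LinearMap.range f).finrank_le
  rw [finrank_self] at this
  omega

/-- The eigenvector relation makes one of the two conditions defining `orth B u` imply the other, so
a single linear functional cuts it out. -/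
theorem IsPencilEigenvector.finrank_le [FiniteDimensional ℂ V] {B : V →ₗ⋆[ℂ] V →ₗ[ℂ] ℂ} {u : V}
    (h : IsPencilEigenvector B u) : finrank ℂ V ≤ finrank ℂ (orth B u) + 1 := by
  obtain ⟨α, β, hαβ, h⟩ := h
  by_cases hβ : β = 0
  · have hα : α ≠ 0 := by simpa [hβ] using hαβ
    refine (finrank_le_finrank_ker_add_one (B u)).trans
      (Nat.add_le_add_right (Submodule.finrank_mono fun y hy => mem_orth.2 ⟨hy, ?_⟩) 1)
    simpa [hβ, hα] using h y
  · let ψ : V →ₗ[ℂ] ℂ :=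
      { toFun := fun y => starRingEnd ℂ (B y u)
        map_add' := fun x y => by simp
        map_smul' := fun s x => by simp }
    refine (finrank_le_finrank_ker_add_one ψ).trans
      (Nat.add_le_add_right (Submodule.finrank_mono fun y hy => ?_) 1)
    have hy : starRingEnd ℂ (B y u) = 0 := hy
    rw [map_eq_zero] at hy
    refine mem_orth.2 ⟨?_, hy⟩
    simpa [hβ, hy] using h y

/-- If no eigenvector of the pencil is isotropic, then there is an orthogonal basis. -/
theorem exists_orthogonal_basis (n : ℕ) : ∀ {V : Type u} [AddCommGroup V] [Module ℂ V]
    [FiniteDimensional ℂ V] (B : V →ₗ⋆[ℂ] V →ₗ[ℂ] ℂ), finrank ℂ V = n →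
    (∀ u, u ≠ 0 → IsPencilEigenvector B u → B u u ≠ 0) →
    ∃ v : Basis (Fin n) ℂ V, (∀ i j, i ≠ j → B (v i) (v j) = 0) ∧ ∀ i, B (v i) (v i) ≠ 0 := by
  suffices ∀ {V : Type u} [AddCommGroup V] [Module ℂ V]
    [FiniteDimensional ℂ V] (B : V →ₗ⋆[ℂ] V →ₗ[ℂ] ℂ), finrank ℂ V = n →
    (∀ u, u ≠ 0 → IsPencilEigenvector B u → B u u ≠ 0) →
    ∃ v : Fin n → V, LinearIndependent ℂ v ∧ (∀ i j, i ≠ j → B (v i) (v j) = 0) ∧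
      ∀ i, B (v i) (v i) ≠ 0 by
    intro V _ _ _ B hn hB
    obtain ⟨v, hv, h⟩ := this B hn hB
    refine ⟨basisOfLinearIndependentOfCardEqFinrank' v hv (by simp [hn]), ?_⟩
    simpa using h
  induction n with
  | zero =>
    intro V _ _ _ B hn hB
    exact ⟨fun i => i.elim0, linearIndependent_empty_type, fun i => i.elim0, fun i => i.elim0⟩
  | succ n ih =>
    intro V _ _ _ B hn hB
    have : Nontrivial V := Module.nontrivial_of_finrank_pos (R := ℂ) (by omega)
    obtain ⟨u, hu, hpu⟩ := exists_isPencilEigenvector B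
    have huu := hB u hu hpu
    have hnot : u ∉ orth B u := fun h => huu (mem_orth.1 h).1
    have hsup := finrank_sup_span_singleton hnot
    have hle := hpu.finrank_le
    have htop : orth B u ⊔ Submodule.span ℂ {u} = ⊤ := by
      apply Submodule.eq_top_of_finrank_eq
      have := Submodule.finrank_le (orth B u ⊔ Submodule.span ℂ {u})
      omega
    have hfin : finrank ℂ (orth B u) = n := by
      rw [htop, finrank_top] at hsup; omega
    -- An eigenvector of the restricted pencil is one on all of `V`, because both terms of the
    -- relation vanish at `u`.
    obtain ⟨v, hv, hoff, hdiag⟩ := ih (B.domRestrict₁₂ (orth B u) (orth B u)) hfin (by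
      rintro ⟨w, hw⟩ hw0 ⟨α, β, hαβ, h⟩
      refine hB w (by simpa using hw0) ⟨α, β, hαβ, fun y => ?_⟩
      have hy : y ∈ orth B u ⊔ Submodule.span ℂ {u} := htop ▸ Submodule.mem_top
      obtain ⟨y', hy', t, ht, rfl⟩ := Submodule.mem_sup.1 hy
      obtain ⟨a, rfl⟩ := Submodule.mem_span_singleton.1 ht
      have h1 := h ⟨y', hy'⟩
      simp only [LinearMap.domRestrict₁₂_apply] at h1
      obtain ⟨h2, h3⟩ := mem_orth.1 hw
      simp [h2, h3, h1])
    refine ⟨Fin.cons u fun i => (v i : V), ?_, ?_, ?_⟩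
    · rw [linearIndependent_finCons]
      refine ⟨hv.map' (orth B u).subtype (Submodule.ker_subtype _), fun hmem => hnot ?_⟩
      refine (Submodule.span_le.2 ?_) hmem
      rintro _ ⟨i, rfl⟩
      exact (v i).2
    · intro i j hij
      refine Fin.cases (fun j hij => ?_) (fun i j hij => ?_) i j hij
      · refine Fin.cases (fun h => absurd rfl h) (fun j _ => ?_) j hij
        simpa using (mem_orth.1 (v j).2).1
      · refine Fin.cases (fun _ => ?_) (fun j hij => ?_) j hij
        · simpa using (mem_orth.1 (v i).2).2
        · exact hoff i j (fun h => hij (by rw [h]))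
    · refine Fin.cases ?_ fun i => ?_
      · simpa using huu
      · exact hdiag i

/-- In an orthogonal basis as above no two diagonal values are on opposite rays. -/
theorem diagonal_ne_neg_smul {n : ℕ} {B : V →ₗ⋆[ℂ] V →ₗ[ℂ] ℂ}
    (hB : ∀ u, u ≠ 0 → IsPencilEigenvector B u → B u u ≠ 0) (v : Basis (Fin n) ℂ V)
    (hoff : ∀ i j, i ≠ j → B (v i) (v j) = 0) (hdiag : ∀ i, B (v i) (v i) ≠ 0) (i j : Fin n)
    {s : ℝ} (hs : 0 < s) : B (v j) (v j) ≠ -(s : ℂ) * B (v i) (v i) := by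
  intro hij
  have hne : i ≠ j := by
    rintro rfl
    have : (1 + (s : ℂ)) * B (v i) (v i) = 0 := by linear_combination hij
    rcases mul_eq_zero.1 this with h | h
    · have : (1 + s : ℝ) = 0 := by exact_mod_cast h
      linarith
    · exact hdiag i h
  have hsq : ((√s : ℝ) : ℂ) * ((√s : ℝ) : ℂ) = s := by exact_mod_cast Real.mul_self_sqrt hs.le
  -- If the values were opposite, this `u` would be isotropic; both values lie on one real line
  -- through `0`, so the same `α`, `β` serve `v i` and `v j`.
  set u := ((√s : ℝ) : ℂ) • v i + v j with hu
  have h1 : ∀ l, B (v l) u = ((√s : ℝ) : ℂ) * B (v l) (v i) + B (v l) (v j) := fun l => by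
    simp only [hu, map_add, map_smul, smul_eq_mul]
  have h2 : ∀ l, B u (v l) = ((√s : ℝ) : ℂ) * B (v i) (v l) + B (v j) (v l) := fun l => by
    simp only [hu, map_add, LinearMap.add_apply, LinearMap.map_smulₛₗ, LinearMap.smul_apply,
      smul_eq_mul, Complex.conj_ofReal]
  have h3 : B u u = ((√s : ℝ) : ℂ) * B u (v i) + B u (v j) := by
    conv_lhs => rw [hu]
    rw [← hu]; simp only [hu, map_add, map_smul, smul_eq_mul]
  refine hB u (fun h0 => ?_) (isPencilEigenvector_of_basis v
    (α := starRingEnd ℂ (B (v i) (v i))) (β := - B (v i) (v i)) (Or.inr (by simpa using hdiag i))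
    fun l => ?_) ?_
  · have := congrArg (fun x => v.repr x j) h0
    simp only [hu, map_add, map_smul, Finsupp.add_apply, Finsupp.smul_apply, Basis.repr_self,
      Finsupp.single_eq_same, Finsupp.single_eq_of_ne hne.symm, map_zero, Finsupp.zero_apply] at this
    simp at this
  · rw [h1, h2]
    by_cases hli : l = i
    · subst hli
      rw [hoff _ _ hne, hoff _ _ hne.symm]
      simp; ring
    · by_cases hlj : l = j
      · subst hlj
        rw [hoff _ _ hne, hoff _ _ hne.symm, hij]
        simp; ring
      · rw [hoff _ _ hli, hoff _ _ hlj, hoff _ _ (Ne.symm hli), hoff _ _ (Ne.symm hlj)]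
        simp
  · rw [h3, h2, h2, hoff _ _ hne, hoff _ _ hne.symm, hij]
    linear_combination (B (v i) (v i)) * hsq

end
end HigherRank
-- The diagonal case: half-plane counting and interlacing.
namespace HigherRank
section
open Filter Topology Module
universe u
variable {V : Type u} [AddCommGroup V] [Module ℂ V]

theorem exists_monotone_enumeration {ι : Type*} (S : Finset ι) (f : ι → ℝ) {n : ℕ}
    (hn : S.card = n) :
    ∃ e : Fin n → ι, Function.Injective e ∧ (∀ i, e i ∈ S) ∧ Monotone (f ∘ e) := by
  let g := (S.equivFinOfCardEq hn).symm
  refine ⟨fun i => g (Tuple.sort (fun j => f (g j)) i), ?_, fun i => (g _).2, ?_⟩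
  · exact Subtype.val_injective.comp (g.injective.comp (Equiv.injective _))
  · exact Tuple.monotone_sort (fun j => f (g j))

theorem sub_le_card_filter_gt {ι : Type*} {S : Finset ι} {f : ι → ℝ} {n : ℕ} {e : Fin n → ι}
    (he : Function.Injective e) (hS : ∀ i, e i ∈ S) (hf : Monotone (f ∘ e)) {j : Fin n} {t : ℝ}
    (ht : t < f (e j)) : n - j ≤ (S.filter fun i => t < f i).card := by
  rw [← Fin.card_Ici, ← Finset.card_map ⟨e, he⟩]
  refine Finset.card_le_card fun i hi => ?_
  obtain ⟨l, hl, rfl⟩ := Finset.mem_map.1 hi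
  exact Finset.mem_filter.2 ⟨hS l, ht.trans_le (hf (Finset.mem_Ici.1 hl))⟩

theorem add_one_le_card_filter_lt {ι : Type*} {S : Finset ι} {f : ι → ℝ} {n : ℕ} {e : Fin n → ι}
    (he : Function.Injective e) (hS : ∀ i, e i ∈ S) (hf : Monotone (f ∘ e)) {j : Fin n} {t : ℝ}
    (ht : f (e j) < t) : j + 1 ≤ (S.filter fun i => f i < t).card := by
  rw [← Fin.card_Iic, ← Finset.card_map ⟨e, he⟩]
  refine Finset.card_le_card fun i hi => ?_
  obtain ⟨l, hl, rfl⟩ := Finset.mem_map.1 hi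
  exact Finset.mem_filter.2 ⟨hS l, (hf (Finset.mem_Iic.1 hl)).trans_lt ht⟩

/-- Two families of reals, with the half-line counting condition, interlace. -/
theorem interlacing_of_card_le {ι : Type*} {P N : Finset ι} {f : ι → ℝ} {k m : ℕ} (hk : 0 < k)
    {p : Fin k → ι} {q : Fin m → ι} (hp : Function.Injective p) (hq : Function.Injective q)
    (hpP : ∀ i, p i ∈ P) (hqN : ∀ i, q i ∈ N) (hpm : Monotone (f ∘ p)) (hqm : Monotone (f ∘ q))
    (hne : ∀ i ∈ P, ∀ j ∈ N, f i ≠ f j)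
    (h₁ : ∀ t, (P.filter fun i => f i < t).card + (N.filter fun i => t < f i).card ≤ m)
    (h₂ : ∀ t, (P.filter fun i => t < f i).card + (N.filter fun i => f i < t).card ≤ m) :
    ∃ hkm : k < m, (∀ j : Fin k, f (q ⟨j, j.2.trans hkm⟩) < f (p j)) ∧
      ∀ j : Fin k, f (p j) < f (q ⟨j + (m - k), by omega⟩) := by
  have hkm : k ≤ m := by
    have := add_one_le_card_filter_lt hp hpP hpm (j := ⟨k - 1, by omega⟩)
      (t := f (p ⟨k - 1, by omega⟩) + 1) (by linarith)
    have := h₁ (f (p ⟨k - 1, by omega⟩) + 1)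
    simp only at *
    omega
  have c1 : ∀ j : Fin k, f (q ⟨j, j.2.trans_le hkm⟩) < f (p j) := fun j => by
    by_contra hcon
    -- A threshold `t` in a wrongly ordered gap would count `(j + 1) + (m - j) = m + 1` elements.
    obtain ⟨t, ht1, ht2⟩ := exists_between
      (lt_of_le_of_ne (not_lt.1 hcon) (hne _ (hpP _) _ (hqN _)))
    have e1 := add_one_le_card_filter_lt hp hpP hpm ht1
    have e2 := sub_le_card_filter_gt hq hqN hqm ht2
    have := h₁ t
    simp only at *
    omega
  have c2 : ∀ j : Fin k, f (p j) < f (q ⟨j + (m - k), by omega⟩) := fun j => by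
    by_contra hcon
    obtain ⟨t, ht1, ht2⟩ := exists_between
      (lt_of_le_of_ne (not_lt.1 hcon) (hne _ (hpP _) _ (hqN _)).symm)
    have e1 := sub_le_card_filter_gt hp hpP hpm ht2
    have e2 := add_one_le_card_filter_lt hq hqN hqm ht1
    have := h₂ t
    simp only at *
    omega
  have hlt : k < m := by
    refine lt_of_le_of_ne hkm fun h => ?_
    subst h
    have := (c1 ⟨0, hk⟩).trans (c2 ⟨0, hk⟩)
    simp at this
  exact ⟨hlt, c1, c2⟩

/-- A combination of an orthogonal family on which `c • B` takes the values `1 + i a j` and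
`-(1 + i b j)` with `a`, `b` interlacing. -/
theorem exists_isotropic_family_of_interlacing (B : V →ₗ⋆[ℂ] V →ₗ[ℂ] ℂ) {c : ℂ} (hc : c ≠ 0)
    {k m : ℕ} (hkm : k < m) (x : Fin k → V) (y : Fin m → V) (a : Fin k → ℝ) (b : Fin m → ℝ)
    (hxx : ∀ i j, c * B (x i) (x j) = if i = j then 1 + a i * Complex.I else 0)
    (hyy : ∀ i j, c * B (y i) (y j) = if i = j then -(1 + b i * Complex.I) else 0)
    (hxy : ∀ i j, B (x i) (y j) = 0) (hyx : ∀ i j, B (y i) (x j) = 0)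
    (h₁ : ∀ j : Fin k, b ⟨j, j.2.trans hkm⟩ < a j)
    (h₂ : ∀ j : Fin k, a j < b ⟨j + (m - k), by omega⟩) :
    ∃ w : Fin k → V, LinearIndependent ℂ w ∧ ∀ i j, B (w i) (w j) = 0 := by
  obtain ⟨Y, hY⟩ := exists_isometry_of_interlacing (fun j => if h : j < k then a ⟨j, h⟩ else 0)
    (fun j => if h : j < m then b ⟨j, h⟩ else 0) k (m - k) (by omega)
    (fun j hj => by simpa [hj, hj.trans hkm] using h₁ ⟨j, hj⟩)
    (fun j hj => by
      have : j + (m - k) < m := by omega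
      simpa [hj, this] using h₂ ⟨j, hj⟩)
  rw [Nat.add_sub_cancel' hkm.le] at hY
  have hY1 : ∀ i j : Fin k, ∑ l : Fin m, (Y l i : ℂ) * Y l j = if i = j then 1 else 0 := by
    intro i j
    have := (hY i i.2 j j.2).1
    rw [Finset.sum_range] at this
    simp only [Fin.val_inj] at this
    have := congrArg (fun r : ℝ => (r : ℂ)) this
    simpa [apply_ite (fun r : ℝ => (r : ℂ))] using this
  have hY2 : ∀ i j : Fin k, ∑ l : Fin m, (b l : ℂ) * ((Y l i : ℂ) * Y l j) =
      if i = j then (a i : ℂ) else 0 := by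
    intro i j
    have := (hY i i.2 j j.2).2
    rw [Finset.sum_range] at this
    simp only [Fin.val_inj, Fin.is_lt, dite_true, Fin.eta] at this
    have := congrArg (fun r : ℝ => (r : ℂ)) this
    simpa [apply_ite (fun r : ℝ => (r : ℂ))] using this
  -- The graph of `Y`: `c * B (w i) (w j)` is the `(i, j)` entry of `(1 + i diag a) - Yᵀ (1 + i diag
  -- b) Y = 0`.
  set w : Fin k → V := fun j => x j + ∑ l : Fin m, (Y l j : ℂ) • y l with hw
  have hxw : ∀ i j, B (x i) (w j) = B (x i) (x j) := fun i j => by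
    simp only [hw, map_add, map_sum, map_smul, hxy, smul_zero, Finset.sum_const_zero, add_zero]
  have hyw : ∀ i j, B (y i) (w j) = Y i j * B (y i) (y i) := fun i j => by
    simp only [hw, map_add, hyx, map_sum, map_smul, smul_eq_mul, zero_add]
    refine Finset.sum_eq_single i (fun l _ hl => ?_) (by simp)
    have := hyy i l
    rw [if_neg (Ne.symm hl), mul_eq_zero] at this
    rw [this.resolve_left hc, mul_zero]
  refine ⟨w, ?_, fun i j => ?_⟩
  · rw [Fintype.linearIndependent_iff]
    intro g hg i
    have h := congrArg (fun z => c * B (x i) z) hg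
    simp only [map_sum, map_smul, hxw, smul_eq_mul, map_zero, mul_zero, Finset.mul_sum] at h
    rw [Finset.sum_eq_single i] at h
    · rw [mul_left_comm, hxx, if_pos rfl, mul_eq_zero] at h
      refine h.resolve_right fun h0 => ?_
      have := congrArg Complex.re h0
      simp at this
    · intro j _ hj
      rw [mul_left_comm, hxx, if_neg (Ne.symm hj), mul_zero]
    · simp
  · have e : ∀ z, B (w i) z = B (x i) z + ∑ l : Fin m, (Y l i : ℂ) * B (y l) z := fun z => by
      simp only [hw, map_add, map_sum, LinearMap.add_apply, LinearMap.sum_apply,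
        LinearMap.map_smulₛₗ, LinearMap.smul_apply, smul_eq_mul, Complex.conj_ofReal]
    apply mul_left_cancel₀ hc
    rw [e, hxw, mul_add, hxx, Finset.mul_sum, mul_zero]
    have : ∀ l : Fin m, c * ((Y l i : ℂ) * B (y l) (w j)) =
        -((Y l i : ℂ) * Y l j) - Complex.I * (b l * ((Y l i : ℂ) * Y l j)) := fun l => by
      have h := hyy l l
      rw [if_pos rfl] at h
      rw [hyw]
      linear_combination ((Y l i : ℂ) * Y l j) * h
    rw [Finset.sum_congr rfl fun l _ => this l, Finset.sum_sub_distrib, Finset.sum_neg_distrib,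
      ← Finset.mul_sum, hY1, hY2]
    split_ifs <;> ring

/-- The diagonal case: an orthogonal family whose diagonal values are such that each open half
plane bounded by a line through `0` misses at least `k` of them. -/
theorem exists_isotropic_family_of_orthogonal {ι : Type*} (B : V →ₗ⋆[ℂ] V →ₗ[ℂ] ℂ) (v : ι → V)
    (hoff : ∀ i j, i ≠ j → B (v i) (v j) = 0) (hdiag : ∀ i, B (v i) (v i) ≠ 0)
    (hanti : ∀ i j, ∀ s : ℝ, 0 < s → B (v j) (v j) ≠ -(s : ℂ) * B (v i) (v i)) {k : ℕ}
    (J : Finset ι)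
    (hJ : ∀ c : ℂ, c ≠ 0 → (J.filter fun i => (c * B (v i) (v i)).re < 0).card + k ≤ J.card) :
    ∃ w : Fin k → V, LinearIndependent ℂ w ∧ ∀ i j, B (w i) (w j) = 0 := by
  classical
  rcases Nat.eq_zero_or_pos k with rfl | hk
  · exact ⟨fun i => i.elim0, linearIndependent_empty_type, fun i => i.elim0⟩
  induction J using Finset.strongInduction with
  | H J ih =>
  -- Strong induction reduces to a `J` from which no element can be dropped, so the bound is an
  -- equality for some `c`.
  by_cases hex : ∃ i ∈ J, ∀ c : ℂ, c ≠ 0 →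
      ((J.erase i).filter fun i => (c * B (v i) (v i)).re < 0).card + k ≤ (J.erase i).card
  · obtain ⟨i, hi, h⟩ := hex
    exact ih _ (Finset.erase_ssubset hi) h
  push Not at hex
  have hJne : J.Nonempty := by
    have := hJ 1 one_ne_zero
    exact Finset.card_pos.1 (by omega)
  obtain ⟨i₀, hi₀⟩ := hJne
  obtain ⟨c, hc, hlt⟩ := hex i₀ hi₀
  have hcard : (J.filter fun i => (c * B (v i) (v i)).re < 0).card + k = J.card := by
    have h1 := hJ c hc
    rw [Finset.card_erase_of_mem hi₀] at hlt
    have h2 : ((J.erase i₀).filter fun i => (c * B (v i) (v i)).re < 0).card ≤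
        (J.filter fun i => (c * B (v i) (v i)).re < 0).card :=
      Finset.card_le_card (Finset.filter_subset_filter _ (Finset.erase_subset _ _))
    omega
  -- Values on the boundary line all lie on one ray, so a slight rotation of `c` turns them negative
  -- while keeping the negative ones; at the extremal `c` this would exceed the bound.
  have hbd : ∀ i ∈ J, (c * B (v i) (v i)).re ≠ 0 := by
    intro i hi hre
    set y := (c * B (v i) (v i)).im with hy
    have hy0 : y ≠ 0 := fun h => mul_ne_zero hc (hdiag i) (Complex.ext hre h)
    have hev : ∀ᶠ δ : ℝ in 𝓝[>] 0, ∀ l ∈ J, (c * B (v l) (v l)).re ≤ 0 →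
        (c * (1 + δ * y * Complex.I) * B (v l) (v l)).re < 0 := by
      rw [Filter.eventually_all_finset]
      intro l hl
      have hform : ∀ δ : ℝ, (c * (1 + δ * y * Complex.I) * B (v l) (v l)).re =
          (c * B (v l) (v l)).re - δ * y * (c * B (v l) (v l)).im := fun δ => by
        rw [show c * (1 + δ * y * Complex.I) * B (v l) (v l) =
          c * B (v l) (v l) + ((δ * y : ℝ) : ℂ) * (Complex.I * (c * B (v l) (v l))) by
            push_cast; ring, Complex.add_re, Complex.re_ofReal_mul, Complex.I_mul_re]
        ring
      simp only [hform]
      rcases lt_trichotomy (c * B (v l) (v l)).re 0 with h | h | h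
      · have : ContinuousAt (fun δ : ℝ => (c * B (v l) (v l)).re -
            δ * y * (c * B (v l) (v l)).im) 0 := by fun_prop
        have := this.eventually_lt (g := fun _ => (0 : ℝ)) continuousAt_const (by simpa using h)
        filter_upwards [nhdsWithin_le_nhds this] with δ hδ _ using hδ
      · filter_upwards [self_mem_nhdsWithin] with δ hδ _
        have hδ : 0 < δ := hδ
        rw [h, zero_sub, neg_lt_zero, mul_assoc]
        refine mul_pos hδ ?_
        by_contra hcon
        set y' := (c * B (v l) (v l)).im with hy'
        have hy0' : y' ≠ 0 := fun h' => mul_ne_zero hc (hdiag l) (Complex.ext h h')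
        have hneg : y * y' < 0 := lt_of_le_of_ne (not_lt.1 hcon) (mul_ne_zero hy0 hy0')
        refine hanti i l (-(y' / y)) (by
          rw [neg_pos, div_neg_iff]
          rcases mul_neg_iff.1 hneg with h | h
          · exact Or.inr ⟨h.2, h.1⟩
          · exact Or.inl ⟨h.2, h.1⟩) ?_
        apply mul_left_cancel₀ hc
        have e1 : c * B (v l) (v l) = y' * Complex.I := by
          apply Complex.ext <;> simp [h, hy']
        have e2 : c * B (v i) (v i) = y * Complex.I := by
          apply Complex.ext <;> simp [hre, hy]
        have hyc : (y : ℂ) ≠ 0 := by exact_mod_cast hy0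
        rw [e1, mul_left_comm, e2]
        push_cast
        field_simp
      · filter_upwards with δ h' using absurd h' (not_le.2 h)
    obtain ⟨δ, hδ, -⟩ := (hev.and self_mem_nhdsWithin).exists
    have hc' : c * (1 + δ * y * Complex.I) ≠ 0 := by
      intro h0
      have := hδ i hi hre.le
      rw [h0] at this
      simp at this
    have h1 := hJ _ hc'
    have h2 : (insert i (J.filter fun i => (c * B (v i) (v i)).re < 0)).card ≤
        (J.filter fun i => (c * (1 + δ * y * Complex.I) * B (v i) (v i)).re < 0).card := by
      refine Finset.card_le_card fun l hl => ?_
      rcases Finset.mem_insert.1 hl with rfl | hl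
      · exact Finset.mem_filter.2 ⟨hi, hδ _ hi hre.le⟩
      · have := Finset.mem_filter.1 hl
        exact Finset.mem_filter.2 ⟨this.1, hδ _ this.1 this.2.le⟩
    rw [Finset.card_insert_of_notMem
      (fun h => (Finset.mem_filter.1 h).2.ne hre)] at h2
    omega
  set N := J.filter fun i => (c * B (v i) (v i)).re < 0 with hN
  set P := J.filter fun i => 0 < (c * B (v i) (v i)).re with hP
  have hPN : P = J.filter fun i => ¬ (c * B (v i) (v i)).re < 0 := by
    refine Finset.filter_congr fun i hi => ?_
    rw [not_lt]
    exact ⟨le_of_lt, fun h => lt_of_le_of_ne h (hbd i hi).symm⟩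
  have hPcard : P.card = k := by
    have := Finset.card_filter_add_card_filter_not (s := J)
      (fun i => (c * B (v i) (v i)).re < 0)
    rw [← hPN, ← hN] at this
    omega
  set f : ι → ℝ := fun i => (c * B (v i) (v i)).im / (c * B (v i) (v i)).re with hf
  have hz : ∀ i ∈ J, c * B (v i) (v i) = (c * B (v i) (v i)).re * (1 + f i * Complex.I) := by
    intro i hi
    have := hbd i hi
    have h : (c * B (v i) (v i)).re * f i = (c * B (v i) (v i)).im := mul_div_cancel₀ _ this
    conv_lhs => rw [← Complex.re_add_im (c * B (v i) (v i)), ← h]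
    push_cast; ring
  -- `Re ((-t - i)(1 + i f)) = f - t`, so these multipliers of `c` turn half-plane counts into
  -- comparisons of slopes with `t`.
  have hrot : ∀ i ∈ J, ∀ t : ℝ, (c * (-t - Complex.I) * B (v i) (v i)).re =
      (c * B (v i) (v i)).re * (f i - t) := by
    intro i hi t
    rw [mul_right_comm, hz i hi, mul_assoc, Complex.re_ofReal_mul]
    simp; ring_nf; simp
  have hct : ∀ t : ℝ, c * (-t - Complex.I) ≠ 0 := fun t =>
    mul_ne_zero hc fun h => by simpa using congrArg Complex.im h
  have hdisj : ∀ g h : ι → Prop, Disjoint (P.filter g) (N.filter h) := fun g h => by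
    rw [Finset.disjoint_left]
    intro i h1 h2
    simp only [hP, hN, Finset.mem_filter] at h1 h2
    linarith [h1.1.2, h2.1.2]
  have h₁ : ∀ t, (P.filter fun i => f i < t).card + (N.filter fun i => t < f i).card ≤ N.card := by
    intro t
    have h1 := hJ _ (hct t)
    rw [← Finset.card_union_of_disjoint (hdisj _ _)]
    have h2 : (P.filter fun i => f i < t) ∪ (N.filter fun i => t < f i) ⊆
        J.filter fun i => (c * (-t - Complex.I) * B (v i) (v i)).re < 0 := by
      intro i hi
      simp only [hP, hN, Finset.mem_union, Finset.mem_filter] at hi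
      rw [Finset.mem_filter]
      rcases hi with ⟨⟨hi, h1⟩, h2⟩ | ⟨⟨hi, h1⟩, h2⟩
      · exact ⟨hi, by rw [hrot i hi]; exact mul_neg_of_pos_of_neg h1 (by linarith)⟩
      · exact ⟨hi, by rw [hrot i hi]; exact mul_neg_of_neg_of_pos h1 (by linarith)⟩
    have h3 := Finset.card_le_card h2
    omega
  have h₂ : ∀ t, (P.filter fun i => t < f i).card + (N.filter fun i => f i < t).card ≤ N.card := by
    intro t
    have h1 := hJ _ (neg_ne_zero.2 (hct t))
    rw [← Finset.card_union_of_disjoint (hdisj _ _)]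
    have h2 : (P.filter fun i => t < f i) ∪ (N.filter fun i => f i < t) ⊆
        J.filter fun i => (-(c * (-t - Complex.I)) * B (v i) (v i)).re < 0 := by
      intro i hi
      simp only [hP, hN, Finset.mem_union, Finset.mem_filter] at hi
      rw [Finset.mem_filter, neg_mul, Complex.neg_re, neg_lt_zero]
      rcases hi with ⟨⟨hi, h1⟩, h2⟩ | ⟨⟨hi, h1⟩, h2⟩
      · exact ⟨hi, by rw [hrot i hi]; exact mul_pos h1 (by linarith)⟩
      · exact ⟨hi, by rw [hrot i hi]; exact mul_pos_of_neg_of_neg h1 (by linarith)⟩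
    have h3 := Finset.card_le_card h2
    omega
  obtain ⟨p, hp, hpP, hpm⟩ := exists_monotone_enumeration P f hPcard
  obtain ⟨q, hq, hqN, hqm⟩ := exists_monotone_enumeration N f rfl
  have hPJ : ∀ i, p i ∈ J ∧ 0 < (c * B (v (p i)) (v (p i))).re := fun i =>
    Finset.mem_filter.1 (hpP i)
  have hNJ : ∀ i, q i ∈ J ∧ (c * B (v (q i)) (v (q i))).re < 0 := fun i =>
    Finset.mem_filter.1 (hqN i)
  obtain ⟨hkm, c1, c2⟩ := interlacing_of_card_le hk hp hq hpP hqN hpm hqm (by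
    intro i hi j hj hij
    have hi := Finset.mem_filter.1 hi
    have hj := Finset.mem_filter.1 hj
    refine hanti i j (-((c * B (v j) (v j)).re / (c * B (v i) (v i)).re))
      (neg_pos.2 (div_neg_of_neg_of_pos hj.2 hi.2)) ?_
    apply mul_left_cancel₀ hc
    have e1 := hz i hi.1
    have e2 := hz j hj.1
    rw [hij] at e1
    have h0 : ((c * B (v i) (v i)).re : ℂ) ≠ 0 := by exact_mod_cast hi.2.ne'
    have h1 := div_mul_cancel₀ ((c * B (v j) (v j)).re : ℂ) h0
    simp only [Complex.ofReal_neg, Complex.ofReal_div, neg_neg]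
    linear_combination e2 - ((c * B (v j) (v j)).re / (c * B (v i) (v i)).re : ℂ) * e1 -
      (1 + f j * Complex.I) * h1) h₁ h₂
  -- Scaling a vector by `r` scales its value by `r²`, which normalises the real part to `±1`.
  set r : ι → ℝ := fun i => (√|(c * B (v i) (v i)).re|)⁻¹ with hr
  have hrr : ∀ i, c * B ((r i : ℂ) • v i) ((r i : ℂ) • v i) =
      ((|(c * B (v i) (v i)).re|⁻¹ : ℝ) : ℂ) * (c * B (v i) (v i)) := fun i => by
    have h : r i * r i = |(c * B (v i) (v i)).re|⁻¹ := by
      rw [hr]; simp only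
      rw [← mul_inv, Real.mul_self_sqrt (abs_nonneg _)]
    rw [map_smul_smul_self, ← h, Complex.conj_ofReal]
    push_cast; ring
  have hro : ∀ i j, i ≠ j → B ((r i : ℂ) • v i) ((r j : ℂ) • v j) = 0 := fun i j hij => by
    simp only [LinearMap.map_smulₛₗ, LinearMap.smul_apply, map_smul, hoff i j hij, smul_zero]
  have hpq : ∀ i j, p i ≠ q j := fun i j h => by
    have h1 := (hPJ i).2
    have h2 := (hNJ j).2
    rw [h] at h1; linarith
  refine exists_isotropic_family_of_interlacing B hc hkm (fun i => (r (p i) : ℂ) • v (p i))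
    (fun i => (r (q i) : ℂ) • v (q i)) (fun i => f (p i)) (fun i => f (q i)) ?_ ?_
    (fun i j => hro _ _ (hpq i j)) (fun i j => hro _ _ (hpq j i).symm) c1 c2
  · intro i j
    split_ifs with h
    · subst h
      have h1 := (hPJ i).2
      have h2 : ((c * B (v (p i)) (v (p i))).re : ℂ) ≠ 0 := by exact_mod_cast h1.ne'
      rw [hrr, abs_of_pos h1, Complex.ofReal_inv]
      conv_lhs => rw [hz _ (hPJ i).1]
      rw [Complex.re_ofReal_mul]
      simp only [Complex.add_re, Complex.one_re, Complex.re_ofReal_mul, Complex.I_re, mul_zero,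
        add_zero, mul_one]
      rw [← mul_assoc, inv_mul_cancel₀ h2, one_mul]
    · rw [hro _ _ (hp.ne h), mul_zero]
  · intro i j
    split_ifs with h
    · subst h
      have h1 := (hNJ i).2
      have h2 : ((c * B (v (q i)) (v (q i))).re : ℂ) ≠ 0 := by exact_mod_cast h1.ne
      rw [hrr, abs_of_neg h1, Complex.ofReal_inv, Complex.ofReal_neg]
      conv_lhs => rw [hz _ (hNJ i).1]
      rw [Complex.re_ofReal_mul]
      simp only [Complex.add_re, Complex.one_re, Complex.re_ofReal_mul, Complex.I_re, mul_zero,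
        add_zero, mul_one]
      rw [← mul_assoc, inv_neg, neg_mul, inv_mul_cancel₀ h2, neg_one_mul]
    · rw [hro _ _ (hq.ne h), mul_zero]

end
end HigherRank
-- Totally isotropic subspaces by induction on dimension.
namespace HigherRank
section
open Module
open scoped ComplexOrder
universe u

/-- If the Hermitian forms `Re (c • B)` have at most `dim V - k` negative squares for all `c`, then
`B` has a totally isotropic subspace of dimension `k`. -/
theorem exists_isotropic_submodule (n : ℕ) : ∀ {V : Type u} [AddCommGroup V] [Module ℂ V]
    [FiniteDimensional ℂ V] (B : V →ₗ⋆[ℂ] V →ₗ[ℂ] ℂ) (k : ℕ), finrank ℂ V = n →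
    (∀ c N, NegOn B c N → finrank ℂ N + k ≤ finrank ℂ V) →
    ∃ S : Submodule ℂ V, finrank ℂ S = k ∧ ∀ x ∈ S, ∀ y ∈ S, B x y = 0 := by
  induction n using Nat.strong_induction_on with
  | _ n ih =>
  intro V _ _ _ B k hn h
  rcases k with _ | k
  · exact ⟨⊥, by simp, fun x hx y _ => by rw [(Submodule.mem_bot ℂ).1 hx]; simp⟩
  by_cases hex : ∃ u, u ≠ 0 ∧ IsPencilEigenvector B u ∧ B u u = 0
  · obtain ⟨u, hu, hpu, huu⟩ := hex
    obtain ⟨V', hV', huV', hlt, hC⟩ := exists_reduction hu huu hpu.finrank_le h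
    obtain ⟨S, hS, hiso⟩ := ih (finrank ℂ V') (hn ▸ hlt) (B.domRestrict₁₂ V' V') k rfl (by
      intro c N hN
      have h1 := hC c (N.map V'.subtype) (Submodule.map_subtype_le _ _) (by
        rintro _ ⟨x, hx, rfl⟩ hx0
        exact hN x hx (fun h => hx0 (by rw [h, map_zero])))
      rw [Submodule.finrank_map_subtype_eq] at h1
      omega)
    have huS : u ∉ S.map V'.subtype := fun hm => huV' (Submodule.map_subtype_le _ _ hm)
    refine ⟨S.map V'.subtype ⊔ Submodule.span ℂ {u}, ?_, ?_⟩
    · rw [finrank_sup_span_singleton huS, Submodule.finrank_map_subtype_eq, hS]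
    · intro x hx y hy
      obtain ⟨_, ⟨s, hs, rfl⟩, w, hw, rfl⟩ := Submodule.mem_sup.1 hx
      obtain ⟨a, rfl⟩ := Submodule.mem_span_singleton.1 hw
      obtain ⟨_, ⟨t, ht, rfl⟩, w', hw', rfl⟩ := Submodule.mem_sup.1 hy
      obtain ⟨b, rfl⟩ := Submodule.mem_span_singleton.1 hw'
      have h1 : B s t = 0 := hiso s hs t ht
      have h2 := mem_orth.1 (hV' s.2)
      have h3 := mem_orth.1 (hV' t.2)
      simp [h1, h2, h3, huu]
  · push Not at hex
    obtain ⟨v, hoff, hdiag⟩ := exists_orthogonal_basis n B hn hex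
    obtain ⟨w, hw, hww⟩ := exists_isotropic_family_of_orthogonal B v hoff hdiag
      (fun i j s hs => diagonal_ne_neg_smul hex v hoff hdiag i j hs) (k := k + 1) Finset.univ (by
        intro c _
        set F := Finset.univ.filter fun i => (c * B (v i) (v i)).re < 0 with hF
        have hli : LinearIndependent ℂ fun i : F => v i :=
          v.linearIndependent.comp _ Subtype.val_injective
        have h1 := h c (Submodule.span ℂ (Set.range fun i : F => v i)) (by
          intro x hx hx0
          obtain ⟨g, rfl⟩ := (Submodule.mem_span_range_iff_exists_fun ℂ).1 hx
          have e : B (∑ i, g i • v i) (∑ i, g i • v i) =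
              ∑ i, starRingEnd ℂ (g i) * (g i * B (v i) (v i)) := by
            simp only [map_sum, LinearMap.sum_apply, LinearMap.map_smulₛₗ, LinearMap.smul_apply,
              map_smul, smul_eq_mul]
            refine Finset.sum_congr rfl fun i _ => ?_
            rw [Finset.sum_eq_single i]
            · ring
            · intro j _ hj
              simp [hoff j i (fun h => hj (Subtype.ext h))]
            · simp
          have hg : ∃ i, g i ≠ 0 := by
            by_contra hcon
            push Not at hcon
            exact hx0 (by simp [hcon])
          obtain ⟨i, hi⟩ := hg
          rw [e, Finset.mul_sum, Complex.re_sum]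
          simp only [re_conj_mul_mul]
          refine Finset.sum_neg' (fun j _ => ?_) ⟨i, Finset.mem_univ _, ?_⟩
          · exact mul_nonpos_of_nonneg_of_nonpos (sq_nonneg _) (Finset.mem_filter.1 j.2).2.le
          · exact mul_neg_of_pos_of_neg (by positivity) (Finset.mem_filter.1 i.2).2)
        rw [finrank_span_eq_card hli, Fintype.card_coe] at h1
        simpa [hn] using h1)
    refine ⟨Submodule.span ℂ (Set.range w), ?_, ?_⟩
    · rw [finrank_span_eq_card hw, Fintype.card_fin]
    · intro x hx y hy
      obtain ⟨f, rfl⟩ := (Submodule.mem_span_range_iff_exists_fun ℂ).1 hx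
      obtain ⟨g, rfl⟩ := (Submodule.mem_span_range_iff_exists_fun ℂ).1 hy
      simp [hww]

/-! ### From forms and subspaces back to matrices and isometries. -/

/-- The sesquilinear form `(x, y) ↦ x* A y`. -/
noncomputable def sesqForm {n : ℕ} (A : Matrix (Fin n) (Fin n) ℂ) :
    (Fin n → ℂ) →ₗ⋆[ℂ] (Fin n → ℂ) →ₗ[ℂ] ℂ :=
  LinearMap.mk₂'ₛₗ (starRingEnd ℂ) (RingHom.id ℂ) (fun x y => star x ⬝ᵥ (A *ᵥ y))
    (fun x y z => by simp [add_dotProduct]) (fun c x y => by simp [smul_dotProduct])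
    (fun x y z => by simp [mulVec_add, dotProduct_add])
    (fun c x y => by simp [mulVec_smul, dotProduct_smul])

theorem sesqForm_apply {n : ℕ} (A : Matrix (Fin n) (Fin n) ℂ) (x y : Fin n → ℂ) :
    sesqForm A x y = star x ⬝ᵥ (A *ᵥ y) := rfl

theorem exists_isometry_range_eq {n m : ℕ} (S : Submodule ℂ (Fin n → ℂ)) (hS : finrank ℂ S = m) :
    ∃ X ∈ isometries n m, LinearMap.range X.mulVecLin = S := by
  set e := (WithLp.linearEquiv 2 ℂ (Fin n → ℂ)).symm
  set S' : Submodule ℂ (EuclideanSpace ℂ (Fin n)) := S.map e.toLinearMap with hS'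
  have hfin : finrank ℂ S' = m := by rw [← hS]; exact LinearEquiv.finrank_map_eq e S
  set b := (stdOrthonormalBasis ℂ S').reindex (finCongr hfin)
  set X : Matrix (Fin n) (Fin m) ℂ := Matrix.of fun i j => (b j : EuclideanSpace ℂ (Fin n)) i with hX
  have hXiso : Xᴴ * X = 1 := by
    ext i j
    have h := orthonormal_iff_ite.1 b.orthonormal i j
    rw [Submodule.coe_inner, EuclideanSpace.inner_eq_star_dotProduct] at h
    rw [mul_apply, one_apply, ← h, dotProduct]
    exact Finset.sum_congr rfl fun l _ => mul_comm _ _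
  have hinj : Function.Injective X.mulVecLin := by
    intro x y hxy
    have h := congrArg (fun z => Xᴴ *ᵥ z) hxy
    simpa [mulVec_mulVec, hXiso] using h
  have hle : LinearMap.range X.mulVecLin ≤ S := by
    rintro _ ⟨x, rfl⟩
    rw [mulVecLin_apply]
    have : X *ᵥ x = ∑ j, x j • (fun i => (b j : EuclideanSpace ℂ (Fin n)) i) := by
      ext i
      simp [mulVec, dotProduct, hX, mul_comm]
    rw [this]
    refine Submodule.sum_mem _ fun j _ => Submodule.smul_mem _ _ ?_
    obtain ⟨y, hy, hyj⟩ := (b j).2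
    rw [← hyj]
    exact hy
  refine ⟨X, hXiso, Submodule.eq_of_le_of_finrank_eq hle ?_⟩
  rw [LinearMap.finrank_range_of_inj hinj, hS, finrank_fin_fun]

theorem finrank_range_of_mem_isometries {n m : ℕ} {X : Matrix (Fin n) (Fin m) ℂ}
    (hX : X ∈ isometries n m) : finrank ℂ (LinearMap.range X.mulVecLin) = m := by
  have hX : Xᴴ * X = 1 := hX
  rw [LinearMap.finrank_range_of_inj, finrank_fin_fun]
  intro x y hxy
  have h := congrArg (fun z => Xᴴ *ᵥ z) hxy
  simpa [mulVec_mulVec, hX] using h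

theorem star_mulVec_dotProduct {n m : ℕ} (X : Matrix (Fin n) (Fin m) ℂ)
    (A : Matrix (Fin n) (Fin n) ℂ) (x y : Fin m → ℂ) :
    star (X *ᵥ x) ⬝ᵥ (A *ᵥ (X *ᵥ y)) = star x ⬝ᵥ ((Xᴴ * A * X) *ᵥ y) := by
  rw [star_mulVec, ← dotProduct_mulVec, mulVec_mulVec, mulVec_mulVec, Matrix.mul_assoc]

theorem star_mulVec_dotProduct_self {n m : ℕ} {X : Matrix (Fin n) (Fin m) ℂ}
    (hX : X ∈ isometries n m) (x : Fin m → ℂ) :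
    star (X *ᵥ x) ⬝ᵥ (X *ᵥ x) = star x ⬝ᵥ x := by
  have hX : Xᴴ * X = 1 := hX
  have h := star_mulVec_dotProduct X 1 x x
  simpa [hX] using h

/-- A nonzero vector with `x* B x = z x* x` witnesses `z ∈ F(B)`. -/
theorem mem_numericalRange_of_ne_zero {m : ℕ} {B : Matrix (Fin m) (Fin m) ℂ} {z : ℂ}
    {x : Fin m → ℂ} (hx : x ≠ 0) (h : star x ⬝ᵥ (B *ᵥ x) = z * (star x ⬝ᵥ x)) :
    z ∈ numericalRange B := by
  have hpos : 0 < star x ⬝ᵥ x := dotProduct_star_self_pos_iff.2 hx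
  obtain ⟨r, hr, hrx⟩ : ∃ r : ℝ, 0 < r ∧ star x ⬝ᵥ x = (r : ℂ) := by
    obtain ⟨h1, h2⟩ := Complex.pos_iff.1 hpos
    exact ⟨_, h1, Complex.ext rfl (by simpa using h2.symm)⟩
  have hs : ((√r : ℝ) : ℂ)⁻¹ * (((√r : ℝ) : ℂ)⁻¹ * r) = 1 := by
    have h1 : √r * √r = r := Real.mul_self_sqrt hr.le
    have h2 : √r ≠ 0 := (Real.sqrt_pos.2 hr).ne'
    have : (√r)⁻¹ * ((√r)⁻¹ * r) = 1 := by
      rw [← mul_assoc, ← mul_inv, h1, inv_mul_cancel₀ hr.ne']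
    exact_mod_cast this
  have hstar : star ((((√r : ℝ) : ℂ)⁻¹) • x) = (((√r : ℝ) : ℂ)⁻¹) • star x := by
    rw [star_smul]; simp [← Complex.ofReal_inv]
  refine ⟨(((√r : ℝ) : ℂ)⁻¹) • x, ?_, ?_⟩
  · rw [hstar, smul_dotProduct, dotProduct_smul, hrx, smul_eq_mul, smul_eq_mul, hs]
  · rw [hstar, smul_dotProduct, mulVec_smul, dotProduct_smul, h, hrx, smul_eq_mul, smul_eq_mul]
    linear_combination z * hs

/-- Since `k + (n - k + 1) > n`, the ranges of `X` and `M` meet in a nonzero vector, whose Rayleigh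
quotient is `z`. -/
theorem mem_numericalRange_of_mem_rankNumericalRange {n k : ℕ} (hkn : k ≤ n)
    {A : Matrix (Fin n) (Fin n) ℂ} {z : ℂ} (hz : z ∈ rankNumericalRange k A)
    {M : Matrix (Fin n) (Fin (n - k + 1)) ℂ} (hM : M ∈ isometries n (n - k + 1)) :
    z ∈ numericalRange (Mᴴ * A * M) := by
  obtain ⟨X, hX, hXA⟩ := hz
  have hdim := Submodule.finrank_sup_add_finrank_inf_eq (LinearMap.range X.mulVecLin)
    (LinearMap.range M.mulVecLin)
  rw [finrank_range_of_mem_isometries hX, finrank_range_of_mem_isometries hM] at hdim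
  have hle := Submodule.finrank_le
    (LinearMap.range X.mulVecLin ⊔ LinearMap.range M.mulVecLin)
  rw [finrank_fin_fun] at hle
  have hne : LinearMap.range X.mulVecLin ⊓ LinearMap.range M.mulVecLin ≠ ⊥ := by
    intro h
    rw [h, finrank_bot] at hdim
    omega
  obtain ⟨v, ⟨⟨a, ha⟩, ⟨b, hb⟩⟩, hv⟩ := (Submodule.ne_bot_iff _).1 hne
  rw [mulVecLin_apply] at ha hb
  refine mem_numericalRange_of_ne_zero (x := b) (fun h => hv (by rw [← hb, h, mulVec_zero])) ?_
  rw [← star_mulVec_dotProduct, ← star_mulVec_dotProduct_self hM, hb, ← ha,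
    star_mulVec_dotProduct, star_mulVec_dotProduct_self hX, hXA, smul_mulVec, one_mulVec,
    dotProduct_smul, smul_eq_mul]

theorem mem_rankNumericalRange_of_forall {n k : ℕ} (hkn : k ≤ n) {A : Matrix (Fin n) (Fin n) ℂ}
    {z : ℂ} (h : ∀ M ∈ isometries n (n - k + 1), z ∈ numericalRange (Mᴴ * A * M)) :
    z ∈ rankNumericalRange k A := by
  obtain ⟨S, hS, hiso⟩ := exists_isotropic_submodule n (sesqForm (A - z • 1)) k (finrank_fin_fun ℂ) (by
    intro c N hN
    -- A larger negative definite `N` would contain the range of some isometry `M`, while `z ∈ F(M*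
    -- A M)` yields a nonzero vector there on which the form vanishes.
    by_contra hcon
    rw [finrank_fin_fun] at hcon
    obtain ⟨w, hw⟩ := exists_linearIndependent_of_le_finrank
      (show n - k + 1 ≤ finrank ℂ N by omega)
    obtain ⟨W, hWN, hW⟩ : ∃ W ≤ N, finrank ℂ W = n - k + 1 :=
      ⟨(Submodule.span ℂ (Set.range w)).map N.subtype, Submodule.map_subtype_le _ _, by
        rw [Submodule.finrank_map_subtype_eq, finrank_span_eq_card hw, Fintype.card_fin]⟩
    obtain ⟨M, hM, hMW⟩ := exists_isometry_range_eq W hW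
    obtain ⟨x, hx1, hxz⟩ := h M hM
    have hMx : M *ᵥ x ∈ N := hWN (hMW ▸ ⟨x, rfl⟩)
    have hne : M *ᵥ x ≠ 0 := fun h0 => by
      have := star_mulVec_dotProduct_self hM x
      rw [h0, hx1] at this
      simp at this
    have h1 := hN _ hMx hne
    rw [sesqForm_apply, sub_mulVec, dotProduct_sub, star_mulVec_dotProduct, hxz, smul_mulVec,
      one_mulVec, dotProduct_smul, star_mulVec_dotProduct_self hM, hx1] at h1
    simp at h1)
  obtain ⟨X, hX, hXS⟩ := exists_isometry_range_eq S hS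
  refine ⟨X, hX, ?_⟩
  have hX' : Xᴴ * X = 1 := hX
  have hzero : Xᴴ * (A - z • 1) * X = 0 := by
    ext i j
    have h1 := hiso (X *ᵥ Pi.single i 1) (hXS ▸ ⟨_, rfl⟩) (X *ᵥ Pi.single j 1) (hXS ▸ ⟨_, rfl⟩)
    rw [sesqForm_apply, star_mulVec_dotProduct] at h1
    simpa using h1
  rw [Matrix.mul_sub, Matrix.sub_mul, sub_eq_zero] at hzero
  rw [hzero]
  simp [hX']

theorem compressionNumericalRange_eq {n m : ℕ} {M : Matrix (Fin n) (Fin m) ℂ}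
    (hM : M ∈ isometries n m) (A : Matrix (Fin n) (Fin n) ℂ) :
    compressionNumericalRange (M * Mᴴ) A = numericalRange (Mᴴ * A * M) := by
  have hM' : Mᴴ * M = 1 := hM
  have hmul : Mᴴ * (M * Mᴴ * A * (M * Mᴴ)) * M = Mᴴ * A * M := by
    calc Mᴴ * (M * Mᴴ * A * (M * Mᴴ)) * M = (Mᴴ * M) * (Mᴴ * A * M) * (Mᴴ * M) := by
          simp only [Matrix.mul_assoc]
      _ = Mᴴ * A * M := by rw [hM', Matrix.one_mul, Matrix.mul_one]
  ext z
  constructor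
  · rintro ⟨_, ⟨y, rfl⟩, h1, h2⟩
    rw [mulVecLin_apply, ← mulVec_mulVec] at h1 h2
    rw [star_mulVec_dotProduct_self hM] at h1
    rw [star_mulVec_dotProduct, hmul] at h2
    exact ⟨_, h1, h2⟩
  · rintro ⟨x, h1, h2⟩
    refine ⟨M *ᵥ x, ⟨M *ᵥ x, ?_⟩, ?_, ?_⟩
    · rw [mulVecLin_apply, mulVec_mulVec, Matrix.mul_assoc, hM', Matrix.mul_one]
    · rw [star_mulVec_dotProduct_self hM, h1]
    · rw [star_mulVec_dotProduct, hmul, h2]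

end
end HigherRank

theorem theorem2p1 (n k : ℕ) (hk : 1 ≤ k) (hkn : k ≤ n) (A : Matrix (Fin n) (Fin n) ℂ) :
    HigherRank.rankNumericalRange k A =
        ⋂ M ∈ HigherRank.isometries n (n - k + 1), HigherRank.numericalRange (Mᴴ * A * M) ∧
    HigherRank.rankNumericalRange k A =
        ⋂ P ∈ HigherRank.projections n (n - k + 1),
          HigherRank.compressionNumericalRange P A := by
  have h : HigherRank.rankNumericalRange k A =
      ⋂ M ∈ HigherRank.isometries n (n - k + 1), HigherRank.numericalRange (Mᴴ * A * M) := by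
    ext z
    simp only [Set.mem_iInter]
    exact ⟨fun hz M hM => HigherRank.mem_numericalRange_of_mem_rankNumericalRange hkn hz hM,
      HigherRank.mem_rankNumericalRange_of_forall hkn⟩
  refine ⟨h, h.trans ?_⟩
  ext z
  simp only [Set.mem_iInter]
  constructor
  · rintro hz _ ⟨M, hM, rfl⟩
    rw [HigherRank.compressionNumericalRange_eq hM]
    exact hz M hM
  · intro hz M hM
    rw [← HigherRank.compressionNumericalRange_eq hM]
    exact hz _ ⟨M, hM, rfl⟩
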